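/- All Hilbert spaces are complex, $L^2=L^2(\mathbb T)$ and $L^\infty=L^\infty(\mathbb T)$ are taken with respect to normalized Lebesgue measure on the unit circle $\mathbb T$, and $U$ is the bilateral shift of multiplicity $1$, that is, multiplication by $\chi(z)=z$ on $L^2$; for $g\in L^\infty$, $g(U)$ is multiplication by $g$ on $L^2$. For measurable $\sigma\subset\mathbb T$ put $L^2(\sigma)=\{h\in L^2: h=0 \text{ a.e. on } \mathbb T\setminus\sigma\}$. A quasiaffinity is a bounded linear operator with zero kernel and dense range. Operators $A$, $B$ are similar ($A\approx B$) if $VA=BV$ for some boundedly invertible $V$, and quasisimilar ($A\sim B$) if $VA=BV$ and $AW=WB$ for some quasiaffinities $V,W$. A contraction is an operator of norm at most $1$, and $T$ is power bounded if $\sup_{n\ge 1}\|T^n\|<\infty$. **Lemma 2.9.** Let $T$ be a bounded operator on a Hilbert space $\mathcal H$, and let $X\colon\mathcal H\to L^2$ and $Y\colon L^2\to\mathcal H$ be quasiaffinities such that $YU=TY$ and $XT=UX$. Then $XY$ commutes with $U$, and there exists $g\in L^\infty$ such that $XY=g(U)$. For any such $g$, let $\sigma\subset\mathbb T$ be a measurable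 set and let $\delta>0$ be such that $|g|\ge\delta$ a.e. on $\sigma$. Put $\mathcal M=\operatorname{clos} Y L^2(\sigma)$. Then $T\mathcal M\subset\mathcal M$, $$T|_{\mathcal M}\approx U|_{L^2(\sigma)}\quad\text{and}\quad P_{\mathcal M^\perp}T|_{\mathcal M^\perp}\sim U|_{L^2(\mathbb T\setminus\sigma)}.$$ If, moreover, $T$ is power bounded and is not similar to a contraction, then $P_{\mathcal M^\perp}T|_{\mathcal M^\perp}$ is not similar to a contraction. -/

import Mathlib

open MeasureTheory
open scoped ENNReal

noncomputable section

/-! ### Operators on Hilbert spaces -/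

section Operators

variable {H K : Type*} [NormedAddCommGroup H] [InnerProductSpace ℂ H]
  [NormedAddCommGroup K] [InnerProductSpace ℂ K]

/-- A quasiaffinity: a bounded operator with zero kernel and dense range. -/
def IsQuasiaffinity (X : H →L[ℂ] K) : Prop :=
  Function.Injective X ∧ DenseRange X

/-- `T` is a quasiaffine transform of `R`: some quasiaffinity `X` satisfies `X T = R X`. -/
def IsQuasiaffineTransform (T : H →L[ℂ] H) (R : K →L[ℂ] K) : Prop :=
  ∃ X : H →L[ℂ] K, IsQuasiaffinity X ∧ X ∘L T = R ∘L X

/-- `T` and `R` are quasisimilar: each is a quasiaffine transform of the other. -/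
def IsQuasisimilar (T : H →L[ℂ] H) (R : K →L[ℂ] K) : Prop :=
  IsQuasiaffineTransform T R ∧ IsQuasiaffineTransform R T

/-- `T` and `R` are similar: some boundedly invertible `X` satisfies `X T = R X`. -/
def IsSimilarOp (T : H →L[ℂ] H) (R : K →L[ℂ] K) : Prop :=
  ∃ X : H ≃L[ℂ] K, (X : H →L[ℂ] K) ∘L T = R ∘L (X : H →L[ℂ] K)

/-- `T` is similar to a contraction. The contraction may be taken on the same space, since
Hilbert spaces with a bounded invertible map between them are unitarily equivalent. -/
def IsSimilarToContraction (T : H →L[ℂ] H) : Prop :=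
  ∃ C : H →L[ℂ] H, ‖C‖ ≤ 1 ∧ IsSimilarOp T C

/-- `T` is power bounded: the norms of its powers are bounded. -/
def IsPowerBounded (T : H →L[ℂ] H) : Prop :=
  ∃ C : ℝ, ∀ n : ℕ, 1 ≤ n → ‖T ^ n‖ ≤ C

/-- The compression `P_N T|_N` of `T` to `N`, as an operator on `N`. -/
def compression (T : H →L[ℂ] H) (N : Submodule ℂ H) [N.HasOrthogonalProjection] : N →L[ℂ] N :=
  N.orthogonalProjectionOnto ∘L T ∘L N.subtypeL

end Operators

/-! ### The unit circle and the bilateral shift -/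

/-- The unit circle, parametrized by `θ ↦ exp (iθ)`. -/
abbrev UnitCirc : Type := AddCircle (2 * Real.pi)

instance factTwoPiPos : Fact (0 < 2 * Real.pi) := ⟨Real.two_pi_pos⟩

/-- Normalized Lebesgue (arc length) measure on the circle. -/
abbrev circMeasure : Measure UnitCirc := AddCircle.haarAddCircle

/-- The space `L²` of the circle. -/
abbrev L2Circ : Type := Lp ℂ 2 circMeasure

/-- The space `L^∞` of the circle. -/
abbrev LinfCirc : Type := Lp ℂ ∞ circMeasure

/-- Multiplication by `g ∈ L^∞` on `L²`. This is `g(U)` for the bilateral shift `U`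
(`U` is multiplication by the coordinate function). -/
def mulOp (g : LinfCirc) : L2Circ →L[ℂ] L2Circ :=
  (ContinuousLinearMap.mul ℂ ℂ).holderL circMeasure ∞ 2 2 g

theorem mulOp_coeFn (g : LinfCirc) (h : L2Circ) :
    (mulOp g h : UnitCirc → ℂ) =ᵐ[circMeasure] fun z => g z * h z :=
  ContinuousLinearMap.coeFn_holder (r := 2) (ContinuousLinearMap.mul ℂ ℂ) g h

/-- The bilateral shift of multiplicity `1`: multiplication by the coordinate function
`χ = exp (iθ)` on `L²`. -/
def bilateralShift : L2Circ →L[ℂ] L2Circ :=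
  mulOp (fourierLp ∞ 1)

/-- `L²(σ)`: the functions in `L²` that vanish a.e. outside `σ`. -/
def L2On (σ : Set UnitCirc) : Submodule ℂ L2Circ where
  carrier := {h | ∀ᵐ z ∂circMeasure, z ∉ σ → h z = 0}
  zero_mem' := by
    filter_upwards [Lp.coeFn_zero ℂ 2 circMeasure] with z hz _
    exact hz
  add_mem' := by
    intro a b ha hb
    filter_upwards [ha, hb, Lp.coeFn_add a b] with z h1 h2 h3 hz
    exact h3.trans (by simp [h1 hz, h2 hz])
  smul_mem' := by
    intro c a ha
    filter_upwards [ha, Lp.coeFn_smul c a] with z h1 h2 hz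
    exact h2.trans (by simp [h1 hz])

theorem bilateralShift_mapsTo (σ : Set UnitCirc) :
    Set.MapsTo bilateralShift (L2On σ) (L2On σ) := by
  intro h hh
  have hh' : ∀ᵐ z ∂circMeasure, z ∉ σ → h z = 0 := hh
  change ∀ᵐ z ∂circMeasure, z ∉ σ → (bilateralShift h) z = 0
  filter_upwards [hh', mulOp_coeFn (fourierLp ∞ 1) h] with z h1 h2 hz
  rw [bilateralShift, h2, h1 hz, mul_zero]

/-- The restriction `U|_{L²(σ)}` of the bilateral shift, as an operator on `L²(σ)`. -/
def bilateralShiftOn (σ : Set UnitCirc) : L2On σ →L[ℂ] L2On σ :=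
  bilateralShift.restrict (bilateralShift_mapsTo σ)

/-- `clos Y L²(σ)`. -/
abbrev closImage {H : Type*} [NormedAddCommGroup H] [InnerProductSpace ℂ H]
    (Y : L2Circ →L[ℂ] H) (σ : Set UnitCirc) : Submodule ℂ H :=
  ((L2On σ).map (Y : L2Circ →ₗ[ℂ] H)).topologicalClosure

end

/-! ### Multiplication operators on the circle -/

/-! The product `XY` commutes with `U`, hence with all integer powers of `U`. It is therefore
determined by the image of `1`, and testing on indicator functions shows that this image is a
bounded function `g`. Since `|g| ≥ δ` on `σ`, the function `1_σ/g` is bounded. Dividing `X` by `g`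
on `σ` gives `R : H → L²(σ)`, which intertwines `T` with `U` and satisfies `R Y h = h` on `L²(σ)`.
So `Y L²(σ)` is already closed, `Y` and `R` give the similarity on `M`, and `Y R` is a bounded
idempotent with range `M` commuting with `T`. For the compression, `X⁻¹(L²(σ)) = M` and `Y⁻¹(M) =
L²(σ)`. Hence `X` and `Y` induce injective maps with dense range between the quotients `H/M` and
`L²/L²(σ)`, realized as `Mᗮ` and `L²(σᶜ)`. Finally `H = M ∔ ker R` with both summands invariant, so
`T` is similar to `U|_{L²(σ)}` plus its compression. The first summand is isometric, so `T` is
similar to a contraction as soon as the compression is. -/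

theorem mulOp_comp_mulOp {a b c : LinfCirc}
    (h : ∀ᵐ z ∂circMeasure, c z = a z * b z) : mulOp a ∘L mulOp b = mulOp c := by
  ext1 f
  apply Lp.ext
  filter_upwards [mulOp_coeFn a (mulOp b f), mulOp_coeFn b f, mulOp_coeFn c f, h] with z h1 h2 h3 h4
  simp only [ContinuousLinearMap.comp_apply, h1, h2, h3, h4, mul_assoc]

theorem mulOp_commute (a b : LinfCirc) : Commute (mulOp a) (mulOp b) := by
  ext1 f
  apply Lp.ext
  filter_upwards [mulOp_coeFn a (mulOp b f), mulOp_coeFn b f, mulOp_coeFn b (mulOp a f),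
    mulOp_coeFn a f] with z h1 h2 h3 h4
  simp only [mul_apply_eq_comp, h1, h2, h3, h4]
  ring

theorem mulOp_fourierLp_apply (m n : ℤ) :
    mulOp (fourierLp ∞ m) (fourierLp 2 n) = (fourierLp 2 (m + n) : L2Circ) := by
  apply Lp.ext
  filter_upwards [mulOp_coeFn (fourierLp ∞ m) (fourierLp 2 n), coeFn_fourierLp ∞ m,
    coeFn_fourierLp 2 n, coeFn_fourierLp 2 (m + n)] with z h1 h2 h3 h4
  rw [h1, h2, h3, h4, fourier_add]

theorem mulOp_fourierLp_comp (m n : ℤ) :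
    mulOp (fourierLp ∞ m) ∘L mulOp (fourierLp ∞ n) = mulOp (fourierLp ∞ (m + n)) := by
  apply mulOp_comp_mulOp
  filter_upwards [coeFn_fourierLp ∞ m, coeFn_fourierLp ∞ n,
    coeFn_fourierLp ∞ (m + n)] with z h2 h3 h4
  rw [h2, h3, h4, fourier_add]

theorem mulOp_fourierLp_zero : mulOp (fourierLp ∞ 0) = 1 := by
  ext1 f
  apply Lp.ext
  filter_upwards [mulOp_coeFn (fourierLp ∞ 0) f, coeFn_fourierLp (T := 2 * Real.pi) ∞ 0]
    with z h1 h2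
  rw [h1, h2]
  simp

theorem norm_bilateralShift_apply (h : L2Circ) : ‖bilateralShift h‖ = ‖h‖ := by
  rw [Lp.norm_def, Lp.norm_def]
  congr 1
  apply eLpNorm_congr_norm_ae
  filter_upwards [mulOp_coeFn (fourierLp ∞ 1) h, coeFn_fourierLp (T := 2 * Real.pi) ∞ 1]
    with z h1 h2
  rw [bilateralShift, h1, h2, norm_mul, fourier_one, Circle.norm_coe, one_mul]

/-- The shift is invertible with inverse multiplication by `χ⁻¹`, so the commutant of `U` also
commutes with negative powers. -/
theorem Commute.mulOp_fourierLp {A : L2Circ →L[ℂ] L2Circ} (hA : Commute A bilateralShift) (n : ℤ) :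
    Commute A (mulOp (fourierLp ∞ n)) := by
  have inv1 : mulOp (fourierLp ∞ (-1)) * bilateralShift = 1 := by
    rw [bilateralShift, ContinuousLinearMap.mul_def, mulOp_fourierLp_comp, ← mulOp_fourierLp_zero]
    norm_num
  have inv2 : bilateralShift * mulOp (fourierLp ∞ (-1)) = 1 := by
    rw [bilateralShift, ContinuousLinearMap.mul_def, mulOp_fourierLp_comp, ← mulOp_fourierLp_zero]
    norm_num
  have hA' : Commute A (mulOp (fourierLp ∞ (-1))) :=
    Commute.units_inv_right (u := ⟨bilateralShift, mulOp (fourierLp ∞ (-1)), inv2, inv1⟩) hA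
  induction n using Int.induction_on with
  | zero => rw [mulOp_fourierLp_zero]; exact Commute.one_right A
  | succ n ih => rw [← mulOp_fourierLp_comp]; exact ih.mul_right hA
  | pred n ih => rw [sub_eq_add_neg, ← mulOp_fourierLp_comp]; exact ih.mul_right hA'

/-- An operator commuting with the bilateral shift is multiplication by the image of `1`. -/
theorem Commute.coeFn_eq_mul {A : L2Circ →L[ℂ] L2Circ} (hA : Commute A bilateralShift)
    (h : L2Circ) :
    (A h : UnitCirc → ℂ) =ᵐ[circMeasure] fun z => A (fourierLp 2 0) z * h z := by
  -- `A 1` is so far only in `L²`, so its product with `h` is formed in `L¹`. Both sides of `key`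
  -- are continuous in the argument and agree on the exponentials, whose span is dense.
  let B : L2Circ →L[ℂ] L2Circ →L[ℂ] Lp ℂ 1 circMeasure :=
    (ContinuousLinearMap.mul ℂ ℂ).holderL circMeasure 2 2 1
  have hB (f g : L2Circ) : (B f g : UnitCirc → ℂ) =ᵐ[circMeasure] fun z => f z * g z :=
    ContinuousLinearMap.coeFn_holder (r := 1) (ContinuousLinearMap.mul ℂ ℂ) f g
  have key : B (fourierLp 2 0) ∘L A = B (A (fourierLp 2 0)) := by
    have hd : Dense (Submodule.span ℂ (Set.range (fourierLp (T := 2 * Real.pi) 2)) :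
        Set L2Circ) := by
      rw [Submodule.dense_iff_topologicalClosure_eq_top]
      exact span_fourierLp_closure_eq_top (by simp)
    refine ContinuousLinearMap.ext_on hd ?_
    rintro _ ⟨n, rfl⟩
    have h1 : A (fourierLp 2 n) = mulOp (fourierLp ∞ n) (A (fourierLp 2 0)) := by
      have := DFunLike.congr_fun (hA.mulOp_fourierLp n) (fourierLp 2 0 : L2Circ)
      simpa [mulOp_fourierLp_apply] using this
    apply Lp.ext
    filter_upwards [hB (fourierLp 2 0) (A (fourierLp 2 n)),
      hB (A (fourierLp 2 0)) (fourierLp 2 n), mulOp_coeFn (fourierLp ∞ n) (A (fourierLp 2 0)),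
      coeFn_fourierLp ∞ n, coeFn_fourierLp 2 n, coeFn_fourierLp 2 0] with z e1 e2 e3 e4 e5 e6
    rw [ContinuousLinearMap.comp_apply, e1, e2, h1, e3, e4, e5, e6]
    simp [mul_comm]
  have key' := DFunLike.congr_fun key h
  filter_upwards [hB (fourierLp 2 0) (A h), hB (A (fourierLp 2 0)) h, coeFn_fourierLp 2 0]
    with z e1 e2 e3
  rw [← e2, ← key', ContinuousLinearMap.comp_apply, e1, e3]
  simp

/-- Applying `A` to the indicator of `s` gives `∫_s |A 1|² ≤ ‖A‖² μ(s)` for every measurable `s`,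
which forces the pointwise bound. -/
theorem Commute.ae_norm_le {A : L2Circ →L[ℂ] L2Circ} (hA : Commute A bilateralShift) :
    ∀ᵐ z ∂circMeasure, ‖A (fourierLp 2 0) z‖ ≤ ‖A‖ := by
  set γ : L2Circ := A (fourierLp 2 0) with hγ
  have hsq : (fun z => ‖γ z‖ₑ ^ (2 : ℝ)) ≤ᵐ[circMeasure] fun _ => ENNReal.ofReal ‖A‖ ^ (2 : ℝ) := by
    refine ae_le_of_forall_setLIntegral_le_of_sigmaFinite₀
      ((Lp.aestronglyMeasurable γ).enorm.pow_const _) fun s hs hμs => ?_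
    have key : eLpNorm (A (indicatorConstLp 2 hs hμs.ne 1)) 2 circMeasure ≤
        ENNReal.ofReal ‖A‖ * eLpNorm (indicatorConstLp 2 hs hμs.ne (1 : ℂ)) 2 circMeasure := by
      have := A.le_opNorm (indicatorConstLp 2 hs hμs.ne 1)
      have h2 := ENNReal.ofReal_le_ofReal this
      rw [ENNReal.ofReal_mul (norm_nonneg _)] at h2
      simpa [Lp.norm_def, ENNReal.ofReal_toReal (Lp.eLpNorm_ne_top _)] using h2
    have e1 : eLpNorm (A (indicatorConstLp 2 hs hμs.ne 1)) 2 circMeasure =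
        (∫⁻ z in s, ‖γ z‖ₑ ^ (2 : ℝ) ∂circMeasure) ^ (1 / 2 : ℝ) := by
      rw [eLpNorm_eq_lintegral_rpow_enorm_toReal (by simp) (by simp), ← lintegral_indicator hs]
      congr 1
      refine lintegral_congr_ae ?_
      filter_upwards [hA.coeFn_eq_mul (indicatorConstLp 2 hs hμs.ne 1),
        indicatorConstLp_coeFn (p := 2) (hs := hs) (hμs := hμs.ne) (c := (1 : ℂ))] with z h1 h2
      rw [h1, h2]
      by_cases hz : z ∈ s <;> simp [hz, hγ]
    have e2 : eLpNorm (indicatorConstLp 2 hs hμs.ne (1 : ℂ)) 2 circMeasure =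
        (circMeasure s) ^ (1 / 2 : ℝ) := by
      rw [eLpNorm_congr_ae indicatorConstLp_coeFn, eLpNorm_indicator_const hs (by simp) (by simp)]
      simp
    rw [e1, e2] at key
    have k2 := ENNReal.rpow_le_rpow key (show (0 : ℝ) ≤ 2 by norm_num)
    rw [ENNReal.mul_rpow_of_nonneg _ _ (by norm_num), ← ENNReal.rpow_mul, ← ENNReal.rpow_mul] at k2
    norm_num at k2
    simpa using k2
  filter_upwards [hsq] with z hz
  have h := (ENNReal.rpow_le_rpow_iff (by norm_num)).1 hz
  rw [← ofReal_norm] at h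
  exact (ENNReal.ofReal_le_ofReal_iff (norm_nonneg _)).1 h

/-- The commutant of the bilateral shift consists of the multiplication operators. -/
theorem Commute.exists_eq_mulOp {A : L2Circ →L[ℂ] L2Circ} (hA : Commute A bilateralShift) :
    ∃ g : LinfCirc, A = mulOp g := by
  have hm : MemLp (A (fourierLp 2 0)) ∞ circMeasure :=
    memLp_top_of_bound (Lp.aestronglyMeasurable _) _ hA.ae_norm_le
  refine ⟨hm.toLp, ?_⟩
  ext1 h
  apply Lp.ext
  filter_upwards [hA.coeFn_eq_mul h, mulOp_coeFn hm.toLp h, hm.coeFn_toLp] with z h1 h2 h3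
  rw [h1, h2, h3]

/-! ### The subspaces `L²(σ)` -/

theorem mem_L2On {σ : Set UnitCirc} {h : L2Circ} :
    h ∈ L2On σ ↔ ∀ᵐ z ∂circMeasure, z ∉ σ → h z = 0 := Iff.rfl

theorem mulOp_mem_L2On (g : LinfCirc) {σ : Set UnitCirc} {h : L2Circ} (hh : h ∈ L2On σ) :
    mulOp g h ∈ L2On σ := by
  rw [mem_L2On] at *
  filter_upwards [hh, mulOp_coeFn g h] with z h1 h2 hz
  rw [h2, h1 hz, mul_zero]

/-- Multiplication by the indicator function of `σ`. -/
noncomputable def indicatorOp {σ : Set UnitCirc} (hσ : MeasurableSet σ) : L2Circ →L[ℂ] L2Circ :=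
  mulOp (indicatorConstLp ∞ hσ (measure_ne_top _ _) 1)

theorem indicatorOp_coeFn {σ : Set UnitCirc} (hσ : MeasurableSet σ) (h : L2Circ) :
    (indicatorOp hσ h : UnitCirc → ℂ) =ᵐ[circMeasure] σ.indicator h := by
  filter_upwards [mulOp_coeFn (indicatorConstLp ∞ hσ (measure_ne_top _ _) 1) h,
    indicatorConstLp_coeFn (p := ∞) (hs := hσ) (hμs := measure_ne_top circMeasure _) (c := (1 : ℂ))]
    with z h1 h2
  rw [indicatorOp, h1, h2]
  by_cases hz : z ∈ σ <;> simp [hz]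

theorem indicatorOp_mem {σ : Set UnitCirc} (hσ : MeasurableSet σ) (h : L2Circ) :
    indicatorOp hσ h ∈ L2On σ := by
  rw [mem_L2On]
  filter_upwards [indicatorOp_coeFn hσ h] with z h1 hz
  rw [h1, Set.indicator_of_notMem hz]

theorem indicatorOp_add_compl {σ : Set UnitCirc} (hσ : MeasurableSet σ) (h : L2Circ) :
    indicatorOp hσ h + indicatorOp hσ.compl h = h := by
  apply Lp.ext
  filter_upwards [indicatorOp_coeFn hσ h, indicatorOp_coeFn hσ.compl h,
    Lp.coeFn_add (indicatorOp hσ h) (indicatorOp hσ.compl h)] with z h1 h2 h3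
  rw [h3, Pi.add_apply, h1, h2, Set.indicator_self_add_compl_apply]

theorem indicatorOp_eq_zero_iff {σ : Set UnitCirc} (hσ : MeasurableSet σ) {h : L2Circ} :
    indicatorOp hσ.compl h = 0 ↔ h ∈ L2On σ := by
  constructor
  · intro h0
    rw [← indicatorOp_add_compl hσ h, h0, add_zero]
    exact indicatorOp_mem hσ h
  · intro hh
    rw [mem_L2On] at hh
    apply Lp.ext
    filter_upwards [hh, indicatorOp_coeFn hσ.compl h, Lp.coeFn_zero ℂ 2 circMeasure] with z h1 h2 h3
    rw [h2, h3]
    by_cases hz : z ∈ σ <;> simp [hz, h1]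

theorem indicatorOp_of_mem {σ : Set UnitCirc} (hσ : MeasurableSet σ) {h : L2Circ}
    (hh : h ∈ L2On σ) : indicatorOp hσ h = h := by
  have := indicatorOp_add_compl hσ h
  rwa [(indicatorOp_eq_zero_iff hσ).2 hh, add_zero] at this

theorem isClosed_L2On {σ : Set UnitCirc} (hσ : MeasurableSet σ) :
    IsClosed (L2On σ : Set L2Circ) := by
  have : (L2On σ : Set L2Circ) = indicatorOp hσ.compl ⁻¹' {0} := by
    ext h
    exact (indicatorOp_eq_zero_iff hσ).symm
  rw [this]
  exact isClosed_singleton.preimage (indicatorOp hσ.compl).continuous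

/-- The multiplier is `1_σ/g`, bounded by `δ⁻¹`. -/
theorem exists_mulOp_comp_eq_indicatorOp {σ : Set UnitCirc} (hσ : MeasurableSet σ) (g : LinfCirc)
    {δ : ℝ} (hδ : 0 < δ) (hg : ∀ᵐ z ∂circMeasure, z ∈ σ → δ ≤ ‖g z‖) :
    ∃ k : LinfCirc, mulOp k ∘L mulOp g = indicatorOp hσ := by
  have hm : MemLp (σ.indicator fun z => (g z)⁻¹) ∞ circMeasure := by
    refine memLp_top_of_bound
      ((Lp.aestronglyMeasurable g).aemeasurable.inv.indicator hσ).aestronglyMeasurable δ⁻¹ ?_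
    filter_upwards [hg] with z hz
    by_cases h : z ∈ σ
    · simpa [h] using inv_anti₀ hδ (hz h)
    · simpa [h] using hδ.le
  refine ⟨hm.toLp, mulOp_comp_mulOp ?_⟩
  filter_upwards [hm.coeFn_toLp, hg, indicatorConstLp_coeFn (p := ∞) (hs := hσ)
    (hμs := measure_ne_top circMeasure _) (c := (1 : ℂ))] with z h1 h2 h3
  rw [h1, h3]
  by_cases h : z ∈ σ
  · have : g z ≠ 0 := norm_pos_iff.1 (hδ.trans_le (h2 h))
    simp [h, this]
  · simp [h]

/-! ### Similarity between different Hilbert spaces -/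

section Similarity

variable {H K : Type*} [NormedAddCommGroup H] [InnerProductSpace ℂ H] [CompleteSpace H]
  [NormedAddCommGroup K] [InnerProductSpace ℂ K] [CompleteSpace K]

/-- Polar decomposition: linearly homeomorphic Hilbert spaces are unitarily equivalent. -/
theorem ContinuousLinearEquiv.nonempty_linearIsometryEquiv (Z : H ≃L[ℂ] K) :
    Nonempty (H ≃ₗᵢ[ℂ] K) := by
  let Z' : H →L[ℂ] K := Z
  let A : H →L[ℂ] H := Z'.adjoint ∘L Z'
  have hA : 0 ≤ A :=
    (ContinuousLinearMap.nonneg_iff_isPositive A).2 (ContinuousLinearMap.isPositive_adjoint_comp_self Z')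
  have hAu : IsUnit A := by
    let W : K →L[ℂ] H := Z.symm
    have h1 : W ∘L Z' = 1 := by ext x; simp [W, Z']
    have h2 : Z' ∘L W = 1 := by ext x; simp [W, Z']
    have h1' : Z'.adjoint ∘L W.adjoint = 1 := by
      rw [← ContinuousLinearMap.adjoint_comp, h1]; rw [← ContinuousLinearMap.star_eq_adjoint, star_one]
    have h2' : W.adjoint ∘L Z'.adjoint = 1 := by
      rw [← ContinuousLinearMap.adjoint_comp, h2]; rw [← ContinuousLinearMap.star_eq_adjoint, star_one]
    refine ⟨⟨A, W ∘L W.adjoint, ?_, ?_⟩, rfl⟩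
    · ext x
      have e1 := DFunLike.congr_fun h2 (W.adjoint x)
      have e2 := DFunLike.congr_fun h1' x
      simp only [ContinuousLinearMap.comp_apply, one_apply_eq_self] at e1 e2
      simp [A, e1, e2]
    · ext x
      have e1 := DFunLike.congr_fun h2' (Z' x)
      have e2 := DFunLike.congr_fun h1 x
      simp only [ContinuousLinearMap.comp_apply, one_apply_eq_self] at e1 e2
      simp [A, e1, e2]
  let B : H →L[ℂ] H := CFC.sqrt A
  have hBB : B * B = A := CFC.sqrt_mul_sqrt_self A hA
  have hBsa : IsSelfAdjoint B := (CFC.sqrt_nonneg A).isSelfAdjoint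
  obtain ⟨u, hu⟩ := (CFC.isUnit_sqrt_iff A hA).2 hAu
  have hnorm (x : H) : ‖B x‖ = ‖Z x‖ := by
    have h : inner ℂ (B x) (B x) = inner ℂ (Z' x) (Z' x) := by
      rw [← ContinuousLinearMap.adjoint_inner_left B, hBsa.adjoint_eq,
        ← ContinuousLinearMap.adjoint_inner_left Z']
      exact congrArg (fun y => inner ℂ y x) (DFunLike.congr_fun hBB x)
    rw [inner_self_eq_norm_sq_to_K, inner_self_eq_norm_sq_to_K] at h
    have h' : ‖B x‖ ^ 2 = ‖Z' x‖ ^ 2 := by exact_mod_cast h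
    exact (sq_eq_sq₀ (norm_nonneg _) (norm_nonneg _)).1 h'
  -- With `B = |Z|`, the identity `‖B x‖ = ‖Z x‖` makes `Z B⁻¹` isometric.
  let e : H ≃L[ℂ] K := (ContinuousLinearEquiv.ofUnit u).symm.trans Z
  refine ⟨⟨e.toLinearEquiv, fun x => ?_⟩⟩
  have h : B ((ContinuousLinearEquiv.ofUnit u).symm x) = x := by
    have := (ContinuousLinearEquiv.ofUnit u).apply_symm_apply x
    change (u : H →L[ℂ] H) _ = x at this
    rwa [hu] at this
  change ‖Z ((ContinuousLinearEquiv.ofUnit u).symm x)‖ = ‖x‖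
  rw [← hnorm, h]

/-- Conjugation by a unitary from `H` to `K` moves the contraction to `H` without changing its norm.
-/
theorem IsSimilarOp.isSimilarToContraction {T : H →L[ℂ] H} {C : K →L[ℂ] K}
    (h : IsSimilarOp T C) (hC : ‖C‖ ≤ 1) : IsSimilarToContraction T := by
  obtain ⟨Z, hZ⟩ := h
  obtain ⟨W⟩ := Z.nonempty_linearIsometryEquiv
  let W' : H ≃L[ℂ] K := W.toContinuousLinearEquiv
  refine ⟨(W'.symm : K →L[ℂ] H) ∘L C ∘L (W' : H →L[ℂ] K), ?_, Z.trans W'.symm, ?_⟩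
  · refine ContinuousLinearMap.opNorm_le_bound _ zero_le_one fun x => ?_
    have h1 : ‖W.symm (C (W x))‖ ≤ 1 * ‖x‖ := by
      rw [W.symm.norm_map, ← W.norm_map x]
      exact C.le_of_opNorm_le hC _
    exact h1
  · ext x
    have := DFunLike.congr_fun hZ x
    simp only [ContinuousLinearMap.comp_apply, ContinuousLinearEquiv.coe_coe] at this
    simp [this]

/-- If `T` is similar to a direct sum of contractions, it is similar to a contraction. -/
theorem isSimilarToContraction_of_prod {H₁ H₂ : Type*}
    [NormedAddCommGroup H₁] [InnerProductSpace ℂ H₁] [CompleteSpace H₁]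
    [NormedAddCommGroup H₂] [InnerProductSpace ℂ H₂] [CompleteSpace H₂]
    {T : H →L[ℂ] H} {C₁ : H₁ →L[ℂ] H₁} {C₂ : H₂ →L[ℂ] H₂} (h₁ : ‖C₁‖ ≤ 1) (h₂ : ‖C₂‖ ≤ 1)
    (Φ : H ≃L[ℂ] H₁ × H₂) (hΦ : ∀ x, Φ (T x) = (C₁ (Φ x).1, C₂ (Φ x).2)) :
    IsSimilarToContraction T := by
  -- The plain product carries the sup norm; the `ℓ²` norm makes the direct sum a Hilbert space.
  let J : WithLp 2 (H₁ × H₂) ≃L[ℂ] H₁ × H₂ := WithLp.prodContinuousLinearEquiv 2 ℂ H₁ H₂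
  let C : WithLp 2 (H₁ × H₂) →L[ℂ] WithLp 2 (H₁ × H₂) :=
    (J.symm : _ →L[ℂ] WithLp 2 (H₁ × H₂)) ∘L (C₁.prodMap C₂) ∘L (J : _ →L[ℂ] H₁ × H₂)
  have hC : ‖C‖ ≤ 1 := by
    refine ContinuousLinearMap.opNorm_le_bound _ zero_le_one fun x => ?_
    rw [one_mul]
    refine (sq_le_sq₀ (norm_nonneg _) (norm_nonneg _)).1 ?_
    rw [WithLp.prod_norm_sq_eq_of_L2, WithLp.prod_norm_sq_eq_of_L2]
    have e1 : ‖(C x).fst‖ ≤ ‖x.fst‖ := by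
      simpa [C, J] using C₁.le_of_opNorm_le h₁ x.fst
    have e2 : ‖(C x).snd‖ ≤ ‖x.snd‖ := by
      simpa [C, J] using C₂.le_of_opNorm_le h₂ x.snd
    gcongr
  refine IsSimilarOp.isSimilarToContraction (C := C) ⟨Φ.trans J.symm, ?_⟩ hC
  ext1 x
  simp [C, hΦ, Prod.map]

end Similarity

/-- Multiplication by the indicator function of `σ`, as a projection onto `L²(σ)`. -/
noncomputable def indicatorProj {σ : Set UnitCirc} (hσ : MeasurableSet σ) :
    L2Circ →L[ℂ] L2On σ :=
  (indicatorOp hσ).codRestrict (L2On σ) (indicatorOp_mem hσ)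

theorem indicatorProj_eq_zero_iff {σ : Set UnitCirc} (hσ : MeasurableSet σ) {h : L2Circ} :
    indicatorProj hσ.compl h = 0 ↔ h ∈ L2On σ := by
  rw [← indicatorOp_eq_zero_iff hσ]
  exact Subtype.ext_iff

theorem indicatorProj_coe {σ : Set UnitCirc} (hσ : MeasurableSet σ) (h : L2On σ) :
    indicatorProj hσ h = h :=
  Subtype.ext (indicatorOp_of_mem hσ h.2)

theorem indicatorProj_bilateralShift {σ : Set UnitCirc} (hσ : MeasurableSet σ) (h : L2Circ) :
    indicatorProj hσ (bilateralShift h) = bilateralShiftOn σ (indicatorProj hσ h) :=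
  Subtype.ext (DFunLike.congr_fun (mulOp_commute _ _) h)

/-! ### The invariant subspace `clos Y L²(σ)` and the compression to its complement -/

section ClosImage

variable {H : Type*} [NormedAddCommGroup H] [InnerProductSpace ℂ H]
  {T : H →L[ℂ] H} {X R : H →L[ℂ] L2Circ} {Y : L2Circ →L[ℂ] H} {σ : Set UnitCirc}

theorem mem_closImage_of_mem {h : L2Circ} (hh : h ∈ L2On σ) : Y h ∈ closImage Y σ :=
  Submodule.le_topologicalClosure _ (Submodule.mem_map_of_mem hh)

/-- If `Y|_{L²(σ)}` has a bounded left inverse `R`, then `Y L²(σ)` is closed. -/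
theorem mem_closImage_iff (hR : ∀ x, R x ∈ L2On σ) (hRY : ∀ h ∈ L2On σ, R (Y h) = h) {x : H} :
    x ∈ closImage Y σ ↔ Y (R x) = x := by
  refine ⟨fun hx => ?_, fun hx => hx ▸ mem_closImage_of_mem (hR x)⟩
  have hc : IsClosed {x : H | Y (R x) = x} :=
    isClosed_eq (Y.continuous.comp R.continuous) continuous_id
  refine closure_minimal ?_ hc hx
  rintro _ ⟨h, hh, rfl⟩
  exact congrArg Y (hRY h hh)

theorem mapsTo_closImage (hYU : Y ∘L bilateralShift = T ∘L Y)
    (hR : ∀ x, R x ∈ L2On σ) (hRY : ∀ h ∈ L2On σ, R (Y h) = h) :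
    Set.MapsTo T (closImage Y σ) (closImage Y σ) := by
  intro x hx
  have h : T (Y (R x)) = Y (bilateralShift (R x)) := (DFunLike.congr_fun hYU (R x)).symm
  rw [← (mem_closImage_iff hR hRY).1 hx, h]
  exact mem_closImage_of_mem (bilateralShift_mapsTo σ (hR x))

theorem isSimilarOp_restrict_closImage (hYU : Y ∘L bilateralShift = T ∘L Y)
    (hRT : R ∘L T = bilateralShift ∘L R)
    (hR : ∀ x, R x ∈ L2On σ) (hRY : ∀ h ∈ L2On σ, R (Y h) = h) :
    IsSimilarOp (T.restrict (mapsTo_closImage hYU hR hRY)) (bilateralShiftOn σ) := by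
  let V : closImage Y σ →L[ℂ] L2On σ := R.restrict fun x _ => hR x
  let W : L2On σ →L[ℂ] closImage Y σ := Y.restrict fun h hh => mem_closImage_of_mem hh
  refine ⟨ContinuousLinearEquiv.equivOfInverse V W
    (fun x => Subtype.ext ((mem_closImage_iff hR hRY).1 x.2))
    (fun h => Subtype.ext (hRY h h.2)), ?_⟩
  ext1 x
  exact Subtype.ext (DFunLike.congr_fun hRT x.1)

variable [CompleteSpace H]

theorem orthogonalProjectionOnto_eq_zero_iff_mem_closImage {x : H} :
    (closImage Y σ)ᗮ.orthogonalProjectionOnto x = 0 ↔ x ∈ closImage Y σ := by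
  have : CompleteSpace (closImage Y σ) :=
    (Submodule.isClosed_topologicalClosure _).completeSpace_coe
  rw [Submodule.orthogonalProjectionOnto_eq_zero_iff, Submodule.orthogonal_orthogonal]

theorem sub_orthogonalProjectionOnto_mem_closImage (x : H) :
    x - (closImage Y σ)ᗮ.orthogonalProjectionOnto x ∈ closImage Y σ := by
  rw [← orthogonalProjectionOnto_eq_zero_iff_mem_closImage, map_sub,
    Submodule.orthogonalProjectionOnto_mem_subspace_eq_self, sub_self]

/-- The orthogonal projection onto `Mᗮ` intertwines `T` with its compression when `M` is
invariant. -/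
theorem compression_orthogonalProjectionOnto
    (hM : Set.MapsTo T (closImage Y σ) (closImage Y σ)) (x : H) :
    compression T (closImage Y σ)ᗮ ((closImage Y σ)ᗮ.orthogonalProjectionOnto x) =
      (closImage Y σ)ᗮ.orthogonalProjectionOnto (T x) := by
  have h := hM (sub_orthogonalProjectionOnto_mem_closImage (Y := Y) (σ := σ) x)
  rw [SetLike.mem_coe, ← orthogonalProjectionOnto_eq_zero_iff_mem_closImage, map_sub, map_sub,
    sub_eq_zero] at h
  exact h.symm

/-- This is the map `H/M → L²/L²(σ)` induced by `X`; it is injective because `M` is the full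
preimage of `L²(σ)`. -/
theorem isQuasiaffineTransform_compression (hX : IsQuasiaffinity X)
    (hXT : X ∘L T = bilateralShift ∘L X)
    (hσ : MeasurableSet σ) (hXM : ∀ x, X x ∈ L2On σ ↔ x ∈ closImage Y σ) :
    IsQuasiaffineTransform (compression T (closImage Y σ)ᗮ) (bilateralShiftOn σᶜ) := by
  let P := (closImage Y σ)ᗮ.orthogonalProjectionOnto
  have hFP (x : H) : indicatorProj hσ.compl (X (P x)) = indicatorProj hσ.compl (X x) := by
    rw [eq_comm, ← sub_eq_zero, ← map_sub, ← map_sub, indicatorProj_eq_zero_iff hσ, hXM]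
    exact sub_orthogonalProjectionOnto_mem_closImage x
  refine ⟨indicatorProj hσ.compl ∘L X ∘L (closImage Y σ)ᗮ.subtypeL, ⟨?_, ?_⟩, ?_⟩
  · refine (injective_iff_map_eq_zero _).2 fun x hx => ?_
    have hx' : (x : H) ∈ closImage Y σ := (hXM x).1 ((indicatorProj_eq_zero_iff hσ).1 hx)
    rw [← orthogonalProjectionOnto_eq_zero_iff_mem_closImage,
      Submodule.orthogonalProjectionOnto_mem_subspace_eq_self] at hx'
    exact hx'
  · have hsurj : Function.Surjective (indicatorProj hσ.compl) :=
      fun h => ⟨h, indicatorProj_coe hσ.compl h⟩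
    have hd := hsurj.denseRange.comp hX.2 (indicatorProj hσ.compl).continuous
    -- By `hFP`, restricting to `Mᗮ` loses nothing of the range.
    refine Dense.mono ?_ hd
    rintro _ ⟨x, rfl⟩
    exact ⟨P x, hFP x⟩
  · ext1 x
    refine (hFP (T x)).trans ?_
    have h1 : X (T x) = bilateralShift (X x) := DFunLike.congr_fun hXT (x : H)
    rw [h1]
    exact indicatorProj_bilateralShift hσ.compl (X x)

/-- Dually, `Y` induces a map `L²/L²(σ) → H/M`, injective by `hMY`. -/
theorem isQuasiaffineTransform_bilateralShiftOn (hY : IsQuasiaffinity Y)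
    (hYU : Y ∘L bilateralShift = T ∘L Y)
    (hσ : MeasurableSet σ) (hM : Set.MapsTo T (closImage Y σ) (closImage Y σ))
    (hMY : ∀ h, Y h ∈ closImage Y σ → h ∈ L2On σ) :
    IsQuasiaffineTransform (bilateralShiftOn σᶜ) (compression T (closImage Y σ)ᗮ) := by
  let P := (closImage Y σ)ᗮ.orthogonalProjectionOnto
  have hPF (h : L2Circ) : P (Y (indicatorProj hσ.compl h)) = P (Y h) := by
    rw [eq_comm, ← sub_eq_zero, ← map_sub, ← map_sub,
      orthogonalProjectionOnto_eq_zero_iff_mem_closImage]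
    refine mem_closImage_of_mem ?_
    rw [← indicatorProj_eq_zero_iff hσ, map_sub, indicatorProj_coe, sub_self]
  refine ⟨P ∘L Y ∘L (L2On σᶜ).subtypeL, ⟨?_, ?_⟩, ?_⟩
  · refine (injective_iff_map_eq_zero _).2 fun h hh => ?_
    have hh' : (h : L2Circ) ∈ L2On σ :=
      hMY _ (orthogonalProjectionOnto_eq_zero_iff_mem_closImage.1 hh)
    rw [← indicatorProj_coe hσ.compl h]
    exact (indicatorProj_eq_zero_iff hσ).2 hh'
  · have hsurj : Function.Surjective P :=
      fun x => ⟨x, Submodule.orthogonalProjectionOnto_mem_subspace_eq_self x⟩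
    have hd := hsurj.denseRange.comp hY.2 P.continuous
    refine Dense.mono ?_ hd
    rintro _ ⟨h, rfl⟩
    exact ⟨indicatorProj hσ.compl h, hPF h⟩
  · ext1 h
    change P (Y (bilateralShift h)) = compression T (closImage Y σ)ᗮ (P (Y h))
    rw [compression_orthogonalProjectionOnto hM]
    exact congrArg P (DFunLike.congr_fun hYU (h : L2Circ))

/-- A bounded left inverse of `Y|_{L²(σ)}` intertwining `T` with the shift splits `T` into the
direct sum of `U|_{L²(σ)}` and the compression of `T`, up to similarity. -/
theorem isSimilarToContraction_of_compression (hYU : Y ∘L bilateralShift = T ∘L Y)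
    (hRT : R ∘L T = bilateralShift ∘L R) (hσ : MeasurableSet σ)
    (hR : ∀ x, R x ∈ L2On σ) (hRY : ∀ h ∈ L2On σ, R (Y h) = h)
    (hC : IsSimilarToContraction (compression T (closImage Y σ)ᗮ)) :
    IsSimilarToContraction T := by
  obtain ⟨C, hC1, V, hV⟩ := hC
  have : CompleteSpace (L2On σ) := (isClosed_L2On hσ).completeSpace_coe
  have hM := mapsTo_closImage hYU hR hRY
  set P := (closImage Y σ)ᗮ.orthogonalProjectionOnto with hP
  let R' : H →L[ℂ] L2On σ := R.codRestrict _ hR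
  let f : H →L[ℂ] L2On σ × (closImage Y σ)ᗮ :=
    R'.prod ((V : (closImage Y σ)ᗮ →L[ℂ] (closImage Y σ)ᗮ) ∘L P)
  -- `1 - Y R` is the projection onto `ker R` along `M`; it lifts `Mᗮ` to the invariant complement
  -- `ker R` of `M`.
  let S : (closImage Y σ)ᗮ →L[ℂ] H :=
    (ContinuousLinearMap.id ℂ H - Y ∘L R) ∘L (closImage Y σ)ᗮ.subtypeL ∘L
      (V.symm : (closImage Y σ)ᗮ →L[ℂ] (closImage Y σ)ᗮ)
  let s : L2On σ × (closImage Y σ)ᗮ →L[ℂ] H := (Y ∘L (L2On σ).subtypeL).coprod S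
  have hPY (h : L2Circ) (hh : h ∈ L2On σ) : P (Y h) = 0 :=
    orthogonalProjectionOnto_eq_zero_iff_mem_closImage.2 (mem_closImage_of_mem hh)
  have hsf : Function.LeftInverse s f := by
    intro x
    -- `x - P x` lies in `M`, so it is fixed by `Y R`.
    have h := (mem_closImage_iff hR hRY).1
      (sub_orthogonalProjectionOnto_mem_closImage (Y := Y) (σ := σ) x)
    rw [map_sub, map_sub] at h
    have e : s (f x) = Y (R x) + ((P x : H) - Y (R (P x))) := by
      simp [s, f, S, R']
    rw [e, ← add_sub_assoc, add_sub_right_comm, h, sub_add_cancel]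
  have hfs : Function.RightInverse s f := by
    rintro ⟨h, y⟩
    have e : s (h, y) = Y h + ((V.symm y : H) - Y (R (V.symm y))) := by
      simp [s, S]
    refine Prod.ext (Subtype.ext ?_) ?_
    · change R (s (h, y)) = h
      rw [e, map_add, map_sub, hRY _ h.2, hRY _ (hR _), sub_self, add_zero]
    · change V (P (s (h, y))) = y
      rw [e, map_add, map_sub, hPY _ h.2, hPY _ (hR _), hP,
        Submodule.orthogonalProjectionOnto_mem_subspace_eq_self]
      simp
  have hU : ‖bilateralShiftOn σ‖ ≤ 1 := by
    refine ContinuousLinearMap.opNorm_le_bound _ zero_le_one fun h => ?_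
    rw [one_mul]
    exact (norm_bilateralShift_apply h).le
  refine isSimilarToContraction_of_prod hU hC1
    (ContinuousLinearEquiv.equivOfInverse f s hsf hfs) fun x => Prod.ext (Subtype.ext ?_) ?_
  · exact DFunLike.congr_fun hRT x
  · change V (P (T x)) = C (V (P x))
    rw [hP, ← compression_orthogonalProjectionOnto hM]
    exact DFunLike.congr_fun hV _

end ClosImage

/-! ### Proof of the lemma -/

theorem lemma2p9 {H : Type*} [NormedAddCommGroup H] [InnerProductSpace ℂ H] [CompleteSpace H]
    (T : H →L[ℂ] H) (X : H →L[ℂ] L2Circ) (Y : L2Circ →L[ℂ] H)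
    (hX : IsQuasiaffinity X) (hY : IsQuasiaffinity Y)
    (hYU : Y ∘L bilateralShift = T ∘L Y) (hXT : X ∘L T = bilateralShift ∘L X) :
    Commute (X ∘L Y) bilateralShift ∧
    (∃ g : LinfCirc, X ∘L Y = mulOp g) ∧
    ∀ g : LinfCirc, X ∘L Y = mulOp g →
    ∀ σ : Set UnitCirc, MeasurableSet σ →
    ∀ δ : ℝ, 0 < δ → (∀ᵐ z ∂circMeasure, z ∈ σ → δ ≤ ‖g z‖) →
      (∃ hM : Set.MapsTo T (closImage Y σ) (closImage Y σ),
        IsSimilarOp (T.restrict hM) (bilateralShiftOn σ)) ∧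
      IsQuasisimilar (compression T (closImage Y σ)ᗮ) (bilateralShiftOn σᶜ) ∧
      (IsPowerBounded T → ¬ IsSimilarToContraction T →
        ¬ IsSimilarToContraction (compression T (closImage Y σ)ᗮ)) := by
  have hcomm : Commute (X ∘L Y) bilateralShift := by
    change (X ∘L Y) ∘L bilateralShift = bilateralShift ∘L (X ∘L Y)
    rw [ContinuousLinearMap.comp_assoc, hYU, ← ContinuousLinearMap.comp_assoc, hXT,
      ContinuousLinearMap.comp_assoc]
  refine ⟨hcomm, hcomm.exists_eq_mulOp, fun g hg σ hσ δ hδ hgδ => ?_⟩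
  obtain ⟨k, hk⟩ := exists_mulOp_comp_eq_indicatorOp hσ g hδ hgδ
  -- Only `k g = 1_σ` is known of `k`, which leaves `k` free where `g` vanishes; the extra indicator
  -- forces the range into `L²(σ)`.
  let R : H →L[ℂ] L2Circ := indicatorOp hσ ∘L mulOp k ∘L X
  have hXY (h : L2Circ) : X (Y h) = mulOp g h := DFunLike.congr_fun hg h
  have hkg (h : L2Circ) : mulOp k (mulOp g h) = indicatorOp hσ h := DFunLike.congr_fun hk h
  have hgk (h : L2Circ) : mulOp g (mulOp k h) = indicatorOp hσ h := by
    rw [← hkg]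
    exact DFunLike.congr_fun (mulOp_commute g k) h
  have hR (x : H) : R x ∈ L2On σ := indicatorOp_mem hσ _
  have hRY (h : L2Circ) (hh : h ∈ L2On σ) : R (Y h) = h := by
    change indicatorOp hσ (mulOp k (X (Y h))) = h
    rw [hXY, hkg, indicatorOp_of_mem hσ hh, indicatorOp_of_mem hσ hh]
  have hRT : R ∘L T = bilateralShift ∘L R := by
    have hc : Commute (indicatorOp hσ * mulOp k) bilateralShift :=
      (mulOp_commute _ _).mul_left (mulOp_commute _ _)
    ext1 x
    have h1 : X (T x) = bilateralShift (X x) := DFunLike.congr_fun hXT x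
    change indicatorOp hσ (mulOp k (X (T x))) = bilateralShift (R x)
    rw [h1]
    exact DFunLike.congr_fun hc (X x)
  have hM := mapsTo_closImage hYU hR hRY
  have hXM (x : H) : X x ∈ L2On σ ↔ x ∈ closImage Y σ := by
    constructor
    · intro hx
      -- Both sides have the same image under the injective `X`, since `g k = 1_σ` fixes `X x`.
      have : Y (mulOp k (X x)) = x := by
        apply hX.1
        rw [hXY, hgk, indicatorOp_of_mem hσ hx]
      exact this ▸ mem_closImage_of_mem (mulOp_mem_L2On k hx)
    · intro hx
      rw [← (mem_closImage_iff hR hRY).1 hx, hXY]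
      exact mulOp_mem_L2On g (hR x)
  have hMY (h : L2Circ) (hh : Y h ∈ closImage Y σ) : h ∈ L2On σ :=
    -- `Y (R (Y h)) = Y h`, and injectivity of `Y` gives `h = R (Y h)`.
    hY.1 ((mem_closImage_iff hR hRY).1 hh) ▸ hR (Y h)
  exact ⟨⟨hM, isSimilarOp_restrict_closImage hYU hRT hR hRY⟩,
    ⟨isQuasiaffineTransform_compression hX hXT hσ hXM,
      isQuasiaffineTransform_bilateralShiftOn hY hYU hσ hM hMY⟩,
    fun _ hT hC => hT (isSimilarToContraction_of_compression hYU hRT hσ hR hRY hC)⟩
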